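/- Let $\varrho\in\mathscr P_2(\mathbb R^d)$ be a Borel probability measure with finite second moment, and let $\mathscr P_\varrho(\mathbb R^{2d})$ be the set of $\gamma\in\mathscr P_2(\mathbb R^d\times\mathbb R^d)$ whose first marginal is $\varrho$; write $\gamma(dx,dy)=\gamma_x(dy)\,\varrho(dx)$ for the disintegration. For $\gamma^1,\gamma^2\in\mathscr P_\varrho(\mathbb R^{2d})$ let $$W_\varrho(\gamma^1,\gamma^2)^2=\int_{\mathbb R^d}W(\gamma^1_x,\gamma^2_x)^2\,\varrho(dx),$$ where $W$ is the quadratic Wasserstein distance on $\mathbb R^d$, let $\mathrm{ADM}_\varrho(\gamma^1,\gamma^2)$ be the set of $\alpha\in\mathscr P_2(\mathbb R^{3d})$ with $(x,y^k)\#\alpha=\gamma^k$ for $k=1,2$ (with $(x,y^1,y^2)$ the coordinates of $\mathbb R^{3d}$), and let $$\mathrm{OPT}_\varrho(\gamma^1,\gamma^2)=\Big\{\alpha\in\mathrm{ADM}_\varrho(\gamma^1,\gamma^2):\ W_\varrho(\gamma^1,\gamma^2)^2=\int_{\mathbb R^{3d}}|y^1-y^2|^2\,d\alpha\Big\}.$$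 For $s\in\mathbb R$ put $s\gamma=(x,sy)\#\gamma$ and $\gamma^1\oplus\gamma^2=\{(x,y^1+y^2)\#\alpha:\alpha\in\mathrm{ADM}_\varrho(\gamma^1,\gamma^2)\}$. Let $C\subset\mathscr P_\varrho(\mathbb R^{2d})$ be a closed convex set, that is, $C$ is nonempty; if $\gamma^k\in C$, $\gamma\in\mathscr P_\varrho(\mathbb R^{2d})$ and $W_\varrho(\gamma^k,\gamma)\to0$, then $\gamma\in C$; and $(1-s)\gamma^1\oplus s\gamma^2\subset C$ for all $\gamma^1,\gamma^2\in C$ and $s\in[0,1]$. Assume moreover that whenever $\eta\in\mathscr P_\varrho(\mathbb R^{2d})$ and $\zeta\in C$ satisfy $$\operatorname{spt}\eta_x\subset\overline{\operatorname{conv}}(\operatorname{spt}\zeta_x)\quad\text{for }\varrho\text{-a.e. }x,$$ with $\overline{\operatorname{conv}}$ the closed convex hull, then $\eta\in C$. Let $\upsilon\in\mathscr P_\varrho(\mathbb R^{2d})$. Then the metric projection $\mathbb P_C(\upsilon)$ of $\upsilon$ onto $C$ is well defined, i.e. there is a unique $\mathbb P_C(\upsilon)\in C$ with $W_\varrho(\upsilon,\mathbb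 P_C(\upsilon))\le W_\varrho(\upsilon,\eta)$ for all $\eta\in C$, and there exists a unique $\mathbb Z_\upsilon\in L^2(\mathbb R^{2d},\upsilon;\mathbb R^d)$ such that $$\mathrm{OPT}_\varrho\big(\upsilon,\mathbb P_C(\upsilon)\big)=\big\{(x,y,\mathbb Z_\upsilon)\#\upsilon\big\}.$$ In particular, every optimal plan between $\upsilon$ and $\mathbb P_C(\upsilon)$ is induced by a map. -/

import Mathlib

open MeasureTheory Filter Topology
open scoped ENNReal

noncomputable section

namespace FibreTransport

/-- The Euclidean space `ℝᵈ`. -/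
abbrev Eu (d : ℕ) : Type := EuclideanSpace ℝ (Fin d)

/-- Finite second moment. On the products `ℝᵈ × ℝᵈ` and `ℝᵈ × ℝᵈ × ℝᵈ` the norm is the maximum of
the Euclidean norms of the components; it is equivalent to the Euclidean norm of `ℝ²ᵈ`, `ℝ³ᵈ`,
so that the condition is the usual one. -/
def FiniteSecondMoment {X : Type*} [NormedAddCommGroup X] [MeasurableSpace X]
    (μ : ProbabilityMeasure X) : Prop :=
  ∫⁻ x, ‖x‖ₑ ^ 2 ∂(μ : Measure X) < ∞

variable {d : ℕ}

/-- The plans `γ ∈ 𝒫₂(ℝᵈ × ℝᵈ)` whose first marginal is `ϱ`. -/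
def Plans (ϱ : ProbabilityMeasure (Eu d)) : Set (ProbabilityMeasure (Eu d × Eu d)) :=
  {γ | FiniteSecondMoment γ ∧ (γ : Measure (Eu d × Eu d)).map Prod.fst = (ϱ : Measure (Eu d))}

/-- The quadratic Wasserstein distance `W` on `ℝᵈ`, with values in `[0, ∞]`. -/
def wasserstein (μ ν : Measure (Eu d)) : ℝ≥0∞ :=
  (⨅ π ∈ {π : Measure (Eu d × Eu d) | π.map Prod.fst = μ ∧ π.map Prod.snd = ν},
    ∫⁻ z, ‖z.1 - z.2‖ₑ ^ 2 ∂π) ^ (1 / 2 : ℝ)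

/-- The fibre measure `γ_x` of the disintegration `γ(dx, dy) = γ_x(dy) ϱ(dx)` of `γ` with respect
to its first marginal (unique up to null sets of that marginal). -/
def fibre (γ : ProbabilityMeasure (Eu d × Eu d)) (x : Eu d) : Measure (Eu d) :=
  (γ : Measure (Eu d × Eu d)).condKernel x

/-- The distance `W_ϱ(γ¹, γ²) = (∫ W(γ¹_x, γ²_x)² ϱ(dx))^(1/2)`, with values in `[0, ∞]`. -/
def fibreDist (ϱ : ProbabilityMeasure (Eu d)) (γ₁ γ₂ : ProbabilityMeasure (Eu d × Eu d)) : ℝ≥0∞ :=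
  (∫⁻ x, wasserstein (fibre γ₁ x) (fibre γ₂ x) ^ 2 ∂(ϱ : Measure (Eu d))) ^ (1 / 2 : ℝ)

/-- `ADM_ϱ(γ¹, γ²)`: the `α ∈ 𝒫₂(ℝ³ᵈ)` with `(x, y¹)#α = γ¹` and `(x, y²)#α = γ²`. -/
def Adm (γ₁ γ₂ : ProbabilityMeasure (Eu d × Eu d)) :
    Set (ProbabilityMeasure (Eu d × Eu d × Eu d)) :=
  {α | FiniteSecondMoment α ∧
    (α : Measure (Eu d × Eu d × Eu d)).map (fun p ↦ (p.1, p.2.1)) = (γ₁ : Measure (Eu d × Eu d)) ∧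
    (α : Measure (Eu d × Eu d × Eu d)).map (fun p ↦ (p.1, p.2.2)) = (γ₂ : Measure (Eu d × Eu d))}

/-- `OPT_ϱ(γ¹, γ²)`: the `α ∈ ADM_ϱ(γ¹, γ²)` with `W_ϱ(γ¹, γ²)² = ∫ |y¹ - y²|² dα`. -/
def Opt (ϱ : ProbabilityMeasure (Eu d)) (γ₁ γ₂ : ProbabilityMeasure (Eu d × Eu d)) :
    Set (ProbabilityMeasure (Eu d × Eu d × Eu d)) :=
  {α | α ∈ Adm γ₁ γ₂ ∧
    fibreDist ϱ γ₁ γ₂ ^ 2 = ∫⁻ p, ‖p.2.1 - p.2.2‖ₑ ^ 2 ∂(α : Measure (Eu d × Eu d × Eu d))}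

/-- Scaling in the fibres: `s γ = (x, s y)#γ`. -/
def scale (s : ℝ) (γ : ProbabilityMeasure (Eu d × Eu d)) : ProbabilityMeasure (Eu d × Eu d) :=
  γ.map (f := fun p ↦ (p.1, s • p.2)) (by fun_prop)

/-- The set-valued sum `γ¹ ⊕ γ² = {(x, y¹ + y²)#α : α ∈ ADM_ϱ(γ¹, γ²)}`. -/
def oplus (γ₁ γ₂ : ProbabilityMeasure (Eu d × Eu d)) : Set (ProbabilityMeasure (Eu d × Eu d)) :=
  {γ | ∃ α ∈ Adm γ₁ γ₂, γ = α.map (f := fun p ↦ (p.1, p.2.1 + p.2.2)) (by fun_prop)}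

/-- Closed convex sets of plans. -/
structure IsClosedConvex (ϱ : ProbabilityMeasure (Eu d))
    (C : Set (ProbabilityMeasure (Eu d × Eu d))) : Prop where
  nonempty : C.Nonempty
  subset : C ⊆ Plans ϱ
  closed : ∀ (γ : ℕ → ProbabilityMeasure (Eu d × Eu d)) (γ' : ProbabilityMeasure (Eu d × Eu d)),
    (∀ k, γ k ∈ C) → γ' ∈ Plans ϱ →
    Tendsto (fun k ↦ fibreDist ϱ (γ k) γ') atTop (𝓝 0) → γ' ∈ C
  convex : ∀ γ₁ ∈ C, ∀ γ₂ ∈ C, ∀ s ∈ Set.Icc (0 : ℝ) 1,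
    oplus (scale (1 - s) γ₁) (scale s γ₂) ⊆ C

/-- Stability of `C` under spreading the fibres within the closed convex hull of their support. -/
def HullStable (ϱ : ProbabilityMeasure (Eu d)) (C : Set (ProbabilityMeasure (Eu d × Eu d))) :
    Prop :=
  ∀ η ∈ Plans ϱ, ∀ ζ ∈ C,
    (∀ᵐ x ∂(ϱ : Measure (Eu d)),
      (fibre η x).support ⊆ closedConvexHull ℝ (fibre ζ x).support) → η ∈ C

/-- `ζ` is a metric projection of `υ` onto `C` with respect to `W_ϱ`. -/
def IsMetricProjection (ϱ : ProbabilityMeasure (Eu d))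
    (C : Set (ProbabilityMeasure (Eu d × Eu d))) (υ ζ : ProbabilityMeasure (Eu d × Eu d)) : Prop :=
  ζ ∈ C ∧ ∀ η ∈ C, fibreDist ϱ υ ζ ≤ fibreDist ϱ υ η

/-- The plan `(x, y, Z)#υ` induced by a map `Z ∈ L²(ℝ²ᵈ, υ; ℝᵈ)`. -/
def inducedPlan (υ : ProbabilityMeasure (Eu d × Eu d))
    (Z : Lp (Eu d) 2 (υ : Measure (Eu d × Eu d))) : ProbabilityMeasure (Eu d × Eu d × Eu d) :=
  υ.map (f := fun p ↦ (p.1, p.2, Z p))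
    (measurable_fst.prodMk (measurable_snd.prodMk (Lp.stronglyMeasurable Z).measurable)).aemeasurable

end FibreTransport

end

noncomputable section

namespace FibreTransport

open ProbabilityTheory

/-! The problem reduces to a projection in the Hilbert space `L²(υ; ℝᵈ)`. A map `Z` stands for the
plan `(x, Z)#υ` (`graphPlan`), and `υ` itself corresponds to the second coordinate `u`. Let `K` be
the set of maps whose plan lies in `C`. It is convex because the joint law of two maps is an
admissible plan, and closed because `W_ϱ` is bounded by the `L²` distance.

Given `η ∈ C` and `α ∈ Adm υ η`, average `y²` conditionally on `(x, y¹)`. The resulting map `W`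
takes values in the closed convex hull of `spt η_x`, so hull stability gives `W ∈ K`. The cost of
`α` is exactly `‖u - W‖² + ∫ |W - y²|² dα` (`exists_barycentre`). With `Z` the projection of `u`
onto `K`, the obtuse-angle inequality yields `cost α ≥ ‖u - Z‖² + ‖W - Z‖² + ∫ |W - y²|² dα`. Hence
no plan in `C` is closer to `υ` than `(x, Z)#υ`. A plan of cost `‖u - Z‖²` has both remainders zero,
so `y² = W = Z`. For another projection `ζ`, almost optimal plans make both remainders small, which
forces `ζ = (x, Z)#υ`.

The passage from `W_ϱ` to plans is `exists_adm_le`. Near-optimal couplings suffice, and they are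
made measurable in `x` by discretization: the fibres are images of Lebesgue measure on `[0, 1]`,
their parametrizations are approximated from a countable dense subset of `L²`, and one coupling is
fixed for each pair of indices. -/

lemma rpow_half_sq (a : ℝ≥0∞) : (a ^ (1 / 2 : ℝ)) ^ 2 = a := by
  rw [← ENNReal.rpow_natCast, ← ENNReal.rpow_mul]; norm_num

lemma sq_rpow_half (a : ℝ≥0∞) : (a ^ 2) ^ (1 / 2 : ℝ) = a := by
  rw [← ENNReal.rpow_natCast, ← ENNReal.rpow_mul]; norm_num

/-! ### Fibres of plans and the upper bound for the distance. -/

/-- Fibres of the image of a disintegrated measure under a map over the base. -/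
lemma ae_fibre_eq_map {d : ℕ} {F : Type*} [MeasurableSpace F] (ϱ : Measure (Eu d))
    [IsProbabilityMeasure ϱ] (κ : Kernel (Eu d) F) [IsMarkovKernel κ]
    {g : Eu d × F → Eu d} (hg : Measurable g) (γ : ProbabilityMeasure (Eu d × Eu d))
    (hγ : (γ : Measure (Eu d × Eu d)) = (ϱ ⊗ₘ κ).map (fun p ↦ (p.1, g p))) :
    ∀ᵐ x ∂ϱ, fibre γ x = (κ x).map (fun y ↦ g (x, y)) := by
  have hfst : (γ : Measure (Eu d × Eu d)).fst = ϱ := by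
    rw [hγ, Measure.fst, Measure.map_map measurable_fst (by fun_prop)]
    change (ϱ ⊗ₘ κ).fst = ϱ
    simp
  let κ' : Kernel (Eu d) (Eu d) := (Kernel.id ×ₖ κ).map g
  have hκ' : ∀ x, κ' x = (κ x).map (fun y ↦ g (x, y)) := by
    intro x
    rw [Kernel.map_apply _ hg, Kernel.prod_apply, Kernel.id_apply, Measure.dirac_prod,
      Measure.map_map hg (by fun_prop)]
    rfl
  have : IsMarkovKernel κ' := Kernel.IsMarkovKernel.map _ hg
  have h : (γ : Measure (Eu d × Eu d)) = (γ : Measure (Eu d × Eu d)).fst ⊗ₘ κ' := by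
    rw [hfst, hγ]
    refine Measure.ext_of_lintegral _ fun f hf ↦ ?_
    rw [lintegral_map hf (by fun_prop), Measure.lintegral_compProd (by fun_prop),
      Measure.lintegral_compProd hf]
    refine lintegral_congr fun x ↦ ?_
    rw [hκ', lintegral_map (by fun_prop) (by fun_prop)]
  have := eq_condKernel_of_measure_eq_compProd κ' h
  rw [hfst] at this
  filter_upwards [this] with x hx
  rw [← hκ', hx, fibre]

lemma wasserstein_sq_le {d : ℕ} {μ ν : Measure (Eu d)} {π : Measure (Eu d × Eu d)}
    (h₁ : π.map Prod.fst = μ) (h₂ : π.map Prod.snd = ν) :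
    wasserstein μ ν ^ 2 ≤ ∫⁻ z, ‖z.1 - z.2‖ₑ ^ 2 ∂π := by
  rw [wasserstein, rpow_half_sq]
  exact iInf₂_le π ⟨h₁, h₂⟩

lemma fibreDist_sq {d : ℕ} (ϱ : ProbabilityMeasure (Eu d))
    (γ₁ γ₂ : ProbabilityMeasure (Eu d × Eu d)) :
    fibreDist ϱ γ₁ γ₂ ^ 2 =
      ∫⁻ x, wasserstein (fibre γ₁ x) (fibre γ₂ x) ^ 2 ∂(ϱ : Measure (Eu d)) := by
  rw [fibreDist, rpow_half_sq]

lemma Adm.map_fst {d : ℕ} {ϱ : ProbabilityMeasure (Eu d)}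
    {γ₁ γ₂ : ProbabilityMeasure (Eu d × Eu d)} (hγ : γ₁ ∈ Plans ϱ)
    {α : ProbabilityMeasure (Eu d × Eu d × Eu d)} (hα : α ∈ Adm γ₁ γ₂) :
    (α : Measure (Eu d × Eu d × Eu d)).fst = ϱ := by
  rw [← hγ.2, ← hα.2.1, Measure.map_map (by fun_prop) (by fun_prop)]
  rfl

/-- Every admissible plan bounds the fibrewise distance from above. -/
lemma fibreDist_sq_le {d : ℕ} {ϱ : ProbabilityMeasure (Eu d)}
    {γ₁ γ₂ : ProbabilityMeasure (Eu d × Eu d)} (hγ : γ₁ ∈ Plans ϱ)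
    {α : ProbabilityMeasure (Eu d × Eu d × Eu d)} (hα : α ∈ Adm γ₁ γ₂) :
    fibreDist ϱ γ₁ γ₂ ^ 2 ≤ ∫⁻ p, ‖p.2.1 - p.2.2‖ₑ ^ 2 ∂(α : Measure (Eu d × Eu d × Eu d)) := by
  have hdis : (ϱ : Measure (Eu d)) ⊗ₘ (α : Measure (Eu d × Eu d × Eu d)).condKernel = α := by
    rw [← Adm.map_fst hγ hα]; exact Measure.disintegrate _ _
  have h₁ := ae_fibre_eq_map (ϱ : Measure (Eu d)) (α : Measure (Eu d × Eu d × Eu d)).condKernel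
    (g := fun p ↦ p.2.1) (by fun_prop) γ₁ (by rw [hdis]; exact hα.2.1.symm)
  have h₂ := ae_fibre_eq_map (ϱ : Measure (Eu d)) (α : Measure (Eu d × Eu d × Eu d)).condKernel
    (g := fun p ↦ p.2.2) (by fun_prop) γ₂ (by rw [hdis]; exact hα.2.2.symm)
  rw [fibreDist_sq]
  conv_rhs => rw [← hdis]
  rw [Measure.lintegral_compProd (by fun_prop)]
  refine lintegral_mono_ae ?_
  filter_upwards [h₁, h₂] with x hx₁ hx₂
  exact wasserstein_sq_le hx₁.symm hx₂.symm

/-- For the maximum norm, a triple is no larger than one of the pairs `(x, y¹)`, `(x, y²)`, so the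
moment condition is inherited from the marginals. -/
lemma mem_adm_of_map {d : ℕ} {γ₁ γ₂ : ProbabilityMeasure (Eu d × Eu d)}
    (h₁ : FiniteSecondMoment γ₁) (h₂ : FiniteSecondMoment γ₂)
    {α : ProbabilityMeasure (Eu d × Eu d × Eu d)}
    (hα₁ : (α : Measure (Eu d × Eu d × Eu d)).map (fun p ↦ (p.1, p.2.1)) = γ₁)
    (hα₂ : (α : Measure (Eu d × Eu d × Eu d)).map (fun p ↦ (p.1, p.2.2)) = γ₂) :
    α ∈ Adm γ₁ γ₂ := by
  refine ⟨?_, hα₁, hα₂⟩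
  rw [FiniteSecondMoment] at *
  rw [← hα₁, lintegral_map (by fun_prop) (by fun_prop)] at h₁
  rw [← hα₂, lintegral_map (by fun_prop) (by fun_prop)] at h₂
  refine lt_of_le_of_lt ?_ (ENNReal.add_lt_top.2 ⟨h₁, h₂⟩)
  rw [← lintegral_add_left (by fun_prop)]
  refine lintegral_mono fun p ↦ ?_
  have : ‖p‖ₑ ≤ ‖(p.1, p.2.1)‖ₑ ∨ ‖p‖ₑ ≤ ‖(p.1, p.2.2)‖ₑ := by
    simp only [enorm_le_iff_norm_le, Prod.norm_def]
    grind
  rcases this with h | h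
  · exact le_add_right (by gcongr)
  · exact le_add_left (by gcongr)

/-! ### Near-optimal couplings depending measurably on the base point. -/

/-- Any coupling of two image measures lifts to a coupling of the source measures. -/
lemma exists_coupling_lift {d : ℕ} {I : Type*} [MeasurableSpace I] [StandardBorelSpace I]
    [Nonempty I] (m : Measure I) [IsProbabilityMeasure m] {T₁ T₂ : I → Eu d}
    (hT₁ : Measurable T₁) (hT₂ : Measurable T₂) (π : Measure (Eu d × Eu d))
    (h₁ : π.map Prod.fst = m.map T₁) (h₂ : π.map Prod.snd = m.map T₂) :
    ∃ ω : Measure (I × I), ω.map Prod.fst = m ∧ ω.map Prod.snd = m ∧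
      ω.map (fun z ↦ (T₁ z.1, T₂ z.2)) = π := by
  have hπ : IsProbabilityMeasure π := by
    have := Measure.isProbabilityMeasure_map (μ := m) hT₁.aemeasurable
    rw [← h₁] at this
    exact (Measure.isProbabilityMeasure_map_iff (by fun_prop)).1 this
  have key : ∀ T : I → Eu d, Measurable T → ∃ k : Kernel (Eu d) I, IsMarkovKernel k ∧
      m.map (fun u ↦ (T u, u)) = m.map T ⊗ₘ k := by
    intro T hT
    have := Measure.isProbabilityMeasure_map (μ := m) (f := fun u ↦ (T u, u)) (by fun_prop)
    refine ⟨(m.map (fun u ↦ (T u, u))).condKernel, inferInstance, ?_⟩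
    have hf : (m.map (fun u ↦ (T u, u))).fst = m.map T := by
      rw [Measure.fst, Measure.map_map (by fun_prop) (by fun_prop)]; rfl
    conv_lhs => rw [← Measure.disintegrate (m.map (fun u ↦ (T u, u)))
      (m.map (fun u ↦ (T u, u))).condKernel, hf]
  obtain ⟨k₁, _, hk₁⟩ := key T₁ hT₁
  obtain ⟨k₂, _, hk₂⟩ := key T₂ hT₂
  -- Gluing: given `(y₁, y₂)` with law `π`, draw `u₁` and `u₂` independently from the conditional
  -- laws of `m` given `T₁ = y₁` and `T₂ = y₂`.
  let ξ : Measure ((Eu d × Eu d) × I × I) :=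
    π ⊗ₘ ((k₁.comap Prod.fst measurable_fst) ×ₖ (k₂.comap Prod.snd measurable_snd))
  have e₁ : ξ.map (fun p ↦ (p.1.1, p.2.1)) = m.map (fun u ↦ (T₁ u, u)) := by
    refine Measure.ext_of_lintegral _ fun f hf ↦ ?_
    rw [hk₁, ← h₁, lintegral_map hf (by fun_prop), Measure.lintegral_compProd (by fun_prop),
      Measure.lintegral_compProd hf, lintegral_map (by fun_prop) (by fun_prop)]
    refine lintegral_congr fun x ↦ ?_
    rw [Kernel.prod_apply, lintegral_prod _ (by fun_prop)]
    simp [Kernel.comap_apply]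
  have e₂ : ξ.map (fun p ↦ (p.1.2, p.2.2)) = m.map (fun u ↦ (T₂ u, u)) := by
    refine Measure.ext_of_lintegral _ fun f hf ↦ ?_
    rw [hk₂, ← h₂, lintegral_map hf (by fun_prop), Measure.lintegral_compProd (by fun_prop),
      Measure.lintegral_compProd hf, lintegral_map (by fun_prop) (by fun_prop)]
    refine lintegral_congr fun x ↦ ?_
    rw [Kernel.prod_apply, lintegral_prod _ (by fun_prop)]
    simp [Kernel.comap_apply]
  have conc : ∀ T : I → Eu d, Measurable T →
      ∀ᵐ p ∂m.map (fun u ↦ (T u, u)), T p.2 = p.1 := by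
    intro T hT
    rw [ae_map_iff (by fun_prop) (measurableSet_eq_fun (by fun_prop) (by fun_prop))]
    exact ae_of_all _ fun _ ↦ rfl
  have c₁ : ∀ᵐ p ∂ξ, T₁ p.2.1 = p.1.1 :=
    ae_of_ae_map (μ := ξ) (f := fun p : (Eu d × Eu d) × I × I ↦ (p.1.1, p.2.1)) (by fun_prop)
      (by rw [e₁]; exact conc T₁ hT₁)
  have c₂ : ∀ᵐ p ∂ξ, T₂ p.2.2 = p.1.2 :=
    ae_of_ae_map (μ := ξ) (f := fun p : (Eu d × Eu d) × I × I ↦ (p.1.2, p.2.2)) (by fun_prop)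
      (by rw [e₂]; exact conc T₂ hT₂)
  refine ⟨ξ.snd, ?_, ?_, ?_⟩
  · have := congrArg (Measure.map Prod.snd) e₁
    rw [Measure.map_map (by fun_prop) (by fun_prop),
      Measure.map_map (by fun_prop) (by fun_prop)] at this
    rw [Measure.snd, Measure.map_map (by fun_prop) (by fun_prop)]
    refine Eq.trans this ?_
    exact Measure.map_id
  · have := congrArg (Measure.map Prod.snd) e₂
    rw [Measure.map_map (by fun_prop) (by fun_prop),
      Measure.map_map (by fun_prop) (by fun_prop)] at this
    rw [Measure.snd, Measure.map_map (by fun_prop) (by fun_prop)]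
    refine Eq.trans this ?_
    exact Measure.map_id
  · rw [Measure.snd, Measure.map_map (by fun_prop) (by fun_prop)]
    have : ξ.map ((fun z : I × I ↦ (T₁ z.1, T₂ z.2)) ∘ Prod.snd) = ξ.map Prod.fst := by
      refine Measure.map_congr ?_
      filter_upwards [c₁, c₂] with p hp₁ hp₂
      exact Prod.ext hp₁ hp₂
    rw [this]
    change ξ.fst = π
    simp [ξ]

lemma eLpNorm_two_sq {X F : Type*} [MeasurableSpace X] [NormedAddCommGroup F] (f : X → F)
    (μ : Measure X) : eLpNorm f 2 μ ^ 2 = ∫⁻ x, ‖f x‖ₑ ^ 2 ∂μ := by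
  rw [eLpNorm_eq_lintegral_rpow_enorm_toReal (by norm_num) (by norm_num)]
  simp only [ENNReal.toReal_ofNat]
  rw [rpow_half_sq]
  simp

lemma eLpNorm_two {X F : Type*} [MeasurableSpace X] [NormedAddCommGroup F] (f : X → F)
    (μ : Measure X) : eLpNorm f 2 μ = (∫⁻ x, ‖f x‖ₑ ^ 2 ∂μ) ^ (1 / 2 : ℝ) := by
  rw [← eLpNorm_two_sq, sq_rpow_half]

/-- The cost of a coupling of a reference measure with itself, transported by two maps. -/
def liftCost {d : ℕ} {J : Type*} [MeasurableSpace J] (ω : Measure (J × J)) (f g : J → Eu d) :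
    ℝ≥0∞ :=
  eLpNorm (fun z ↦ f z.1 - g z.2) 2 ω

/-- Minkowski's inequality in `L²(ω)`: since both marginals of `ω` are `m`, the errors keep their
`L²(m)` norms when pulled back to the product. -/
lemma liftCost_triangle {d : ℕ} {J : Type*} [MeasurableSpace J] {m : Measure J}
    {ω : Measure (J × J)} (h₁ : ω.map Prod.fst = m) (h₂ : ω.map Prod.snd = m)
    {f g f' g' : J → Eu d} (hf : StronglyMeasurable f) (hg : StronglyMeasurable g)
    (hf' : StronglyMeasurable f') (hg' : StronglyMeasurable g') :
    liftCost ω f g ≤ eLpNorm (f - f') 2 m + liftCost ω f' g' + eLpNorm (g - g') 2 m := by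
  have e₁ : eLpNorm (f - f') 2 m = eLpNorm ((f - f') ∘ Prod.fst) 2 ω := by
    rw [← h₁, eLpNorm_map_measure (hf.sub hf').aestronglyMeasurable (by fun_prop)]
  have e₂ : eLpNorm (g - g') 2 m = eLpNorm ((g' - g) ∘ Prod.snd) 2 ω := by
    rw [eLpNorm_sub_comm, ← h₂,
      eLpNorm_map_measure (hg'.sub hg).aestronglyMeasurable (by fun_prop)]
  have m₁ : AEStronglyMeasurable ((f - f') ∘ (Prod.fst : J × J → J)) ω :=
    ((hf.sub hf').comp_measurable measurable_fst).aestronglyMeasurable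
  have m₂ : AEStronglyMeasurable ((g' - g) ∘ (Prod.snd : J × J → J)) ω :=
    ((hg'.sub hg).comp_measurable measurable_snd).aestronglyMeasurable
  have m₃ : AEStronglyMeasurable (fun z : J × J ↦ f' z.1 - g' z.2) ω :=
    ((hf'.comp_measurable measurable_fst).sub
      (hg'.comp_measurable measurable_snd)).aestronglyMeasurable
  have e : (fun z : J × J ↦ f z.1 - g z.2) =
      (f - f') ∘ Prod.fst + (fun z ↦ f' z.1 - g' z.2) + (g' - g) ∘ Prod.snd := by
    ext1 z; simp only [Pi.add_apply, Function.comp_apply, Pi.sub_apply]; abel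
  rw [e₁, e₂, liftCost, liftCost, e]
  refine (eLpNorm_add_le (m₁.add m₃) m₂ (by norm_num)).trans ?_
  gcongr
  exact eLpNorm_add_le m₁ m₃ (by norm_num)

/-- Measurable choice of an approximation from a countable dense family. -/
lemma exists_measurable_approx {d : ℕ} {X J : Type*} [MeasurableSpace X] [MeasurableSpace J]
    {m : Measure J} [IsFiniteMeasure m] {G : ℕ → Lp (Eu d) 2 m} (hG : DenseRange G)
    {T : X → J → Eu d} (hT : Measurable (Function.uncurry T)) {ε : ℝ≥0∞} (hε : ε ≠ 0) :
    ∃ N : X → ℕ, Measurable N ∧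
      ∀ x, eLpNorm (T x) 2 m ≠ ∞ → eLpNorm (T x - ⇑(G (N x))) 2 m ≤ ε := by
  classical
  have hmeas : ∀ g : Lp (Eu d) 2 m, Measurable fun x ↦ eLpNorm (T x - ⇑g) 2 m := by
    intro g
    have hg := (Lp.stronglyMeasurable g).measurable
    simp_rw [eLpNorm_two]
    refine Measurable.pow_const ?_ _
    have : Measurable (Function.uncurry fun (x : X) (u : J) ↦ ‖(T x - ⇑g) u‖ₑ ^ 2) := by
      have : Measurable fun p : X × J ↦ ‖Function.uncurry T p - g p.2‖ₑ ^ 2 := by fun_prop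
      exact this
    exact this.lintegral_prod_right'
  have hmeas₀ : Measurable fun x ↦ eLpNorm (T x) 2 m := by
    simp_rw [eLpNorm_two]
    refine Measurable.pow_const ?_ _
    have : Measurable (Function.uncurry fun (x : X) (u : J) ↦ ‖T x u‖ₑ ^ 2) := by
      have : Measurable fun p : X × J ↦ ‖Function.uncurry T p‖ₑ ^ 2 := by fun_prop
      exact this
    exact this.lintegral_prod_right'
  -- The first alternative makes the search for the least index succeed at every `x`, with value `0`
  -- where the norm is infinite.
  have hex : ∀ x, ∃ n, eLpNorm (T x) 2 m = ∞ ∨ eLpNorm (T x - ⇑(G n)) 2 m ≤ ε := by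
    intro x
    by_cases hx : eLpNorm (T x) 2 m = ∞
    · exact ⟨0, Or.inl hx⟩
    · have hL : MemLp (T x) 2 m :=
        ⟨(hT.comp measurable_prodMk_left).aestronglyMeasurable, lt_top_iff_ne_top.2 hx⟩
      obtain ⟨n, hn⟩ := hG.exists_mem_open (Metric.isOpen_eball (x := hL.toLp (T x)) (ε := ε))
        ⟨hL.toLp (T x), Metric.mem_eball_self (pos_iff_ne_zero.2 hε)⟩
      refine ⟨n, Or.inr ?_⟩
      rw [Metric.mem_eball, edist_comm, Lp.edist_def] at hn
      refine le_trans (le_of_eq ?_) hn.le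
      refine eLpNorm_congr_ae ?_
      filter_upwards [hL.coeFn_toLp] with u hu
      simp [hu]
  refine ⟨fun x ↦ Nat.find (hex x), ?_, fun x hx ↦ ?_⟩
  · refine measurable_find hex fun n ↦ ?_
    exact (measurableSet_eq_fun hmeas₀ measurable_const).union
      (measurableSet_le (hmeas _) measurable_const)
  · exact (Nat.find_spec (hex x)).resolve_left hx

/-- A near-optimal coupling of a reference measure with itself. -/
lemma exists_liftCost_le {d : ℕ} {J : Type*} [MeasurableSpace J] {m : Measure J}
    [IsProbabilityMeasure m] (f g : Lp (Eu d) 2 m) {ε : ℝ≥0∞} (hε : ε ≠ 0) :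
    ∃ ω : Measure (J × J), (ω.map Prod.fst = m ∧ ω.map Prod.snd = m) ∧
      ∀ ω' : Measure (J × J), ω'.map Prod.fst = m → ω'.map Prod.snd = m →
        liftCost ω f g ≤ liftCost ω' f g + ε := by
  let S := {ω : Measure (J × J) | ω.map Prod.fst = m ∧ ω.map Prod.snd = m}
  have hprod : m.prod m ∈ S := ⟨by simp, by simp⟩
  have hfin : ⨅ ω ∈ S, liftCost ω f g ≠ ∞ := by
    refine ne_top_of_le_ne_top ?_ (iInf₂_le (m.prod m) hprod)
    have h0 : liftCost (m.prod m) (0 : J → Eu d) (0 : J → Eu d) = 0 := by simp [liftCost]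
    refine ne_top_of_le_ne_top ?_ (liftCost_triangle (m := m) hprod.1 hprod.2
      (Lp.stronglyMeasurable f) (Lp.stronglyMeasurable g)
      (stronglyMeasurable_zero) (stronglyMeasurable_zero))
    rw [h0]
    simp [Lp.eLpNorm_ne_top]
  obtain ⟨ω, hω⟩ := iInf_lt_iff.1 (ENNReal.lt_add_right hfin hε)
  obtain ⟨hS, hlt⟩ := iInf_lt_iff.1 hω
  refine ⟨ω, hS, fun ω' h₁ h₂ ↦ hlt.le.trans ?_⟩
  gcongr
  exact iInf₂_le ω' ⟨h₁, h₂⟩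

lemma Plans.disintegrate {d : ℕ} {ϱ : ProbabilityMeasure (Eu d)}
    {γ : ProbabilityMeasure (Eu d × Eu d)} (hγ : γ ∈ Plans ϱ) :
    (ϱ : Measure (Eu d)) ⊗ₘ (γ : Measure (Eu d × Eu d)).condKernel = γ := by
  have hfst : (γ : Measure (Eu d × Eu d)).fst = ϱ := hγ.2
  rw [← hfst]; exact Measure.disintegrate _ _

lemma lintegral_snd_sq_lt_top {d : ℕ} {γ : ProbabilityMeasure (Eu d × Eu d)}
    (hγ : FiniteSecondMoment γ) : ∫⁻ p, ‖p.2‖ₑ ^ 2 ∂(γ : Measure (Eu d × Eu d)) < ∞ := by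
  refine lt_of_le_of_lt (lintegral_mono fun p ↦ ?_) hγ
  have : ‖p.2‖ₑ ≤ ‖p‖ₑ := enorm_le_iff_norm_le.2 (norm_snd_le p)
  gcongr

lemma Plans.ae_fibre_lt_top {d : ℕ} {ϱ : ProbabilityMeasure (Eu d)}
    {γ : ProbabilityMeasure (Eu d × Eu d)} (hγ : γ ∈ Plans ϱ) :
    ∀ᵐ x ∂(ϱ : Measure (Eu d)), ∫⁻ y, ‖y‖ₑ ^ 2 ∂fibre γ x < ∞ := by
  have h := lintegral_snd_sq_lt_top hγ.1
  rw [← Plans.disintegrate hγ, Measure.lintegral_compProd (by fun_prop)] at h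
  exact ae_lt_top (Measurable.lintegral_kernel (by fun_prop)) h.ne

open scoped unitInterval in
/-- Almost optimal plans for the fibrewise distance. -/
lemma exists_adm_le {d : ℕ} {ϱ : ProbabilityMeasure (Eu d)}
    {γ₁ γ₂ : ProbabilityMeasure (Eu d × Eu d)} (hγ₁ : γ₁ ∈ Plans ϱ) (hγ₂ : γ₂ ∈ Plans ϱ)
    {ε₀ : ℝ≥0∞} (hε₀ : ε₀ ≠ 0) :
    ∃ α ∈ Adm γ₁ γ₂,
      (∫⁻ p, ‖p.2.1 - p.2.2‖ₑ ^ 2 ∂(α : Measure (Eu d × Eu d × Eu d))) ^ (1 / 2 : ℝ) ≤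
        fibreDist ϱ γ₁ γ₂ + ε₀ := by
  -- Five errors occur: two for replacing `T₁`, `T₂` by dense maps, one for near-optimality, two for
  -- returning to `T₁`, `T₂`.
  obtain ⟨ε, hε, rfl⟩ : ∃ ε : ℝ≥0∞, ε ≠ 0 ∧ ε₀ = 5 * ε :=
    ⟨ε₀ / 5, by simpa using hε₀, (ENNReal.mul_div_cancel (by norm_num) (by norm_num)).symm⟩
  obtain ⟨T₁, hT₁, hT₁'⟩ := Kernel.exists_measurable_map_eq_unitInterval
    (γ₁ : Measure (Eu d × Eu d)).condKernel
  obtain ⟨T₂, hT₂, hT₂'⟩ := Kernel.exists_measurable_map_eq_unitInterval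
    (γ₂ : Measure (Eu d × Eu d)).condKernel
  have : Fact ((2 : ℝ≥0∞) ≠ ∞) := ⟨by norm_num⟩
  have hG := TopologicalSpace.denseRange_denseSeq (Lp (Eu d) 2 (volume : Measure I))
  set G := TopologicalSpace.denseSeq (Lp (Eu d) 2 (volume : Measure I))
  obtain ⟨N₁, hN₁, hN₁'⟩ := exists_measurable_approx hG hT₁ hε
  obtain ⟨N₂, hN₂, hN₂'⟩ := exists_measurable_approx hG hT₂ hε
  choose Ω hΩ hΩ' using fun i j ↦ exists_liftCost_le (G i) (G j) hε
  have hprob : ∀ n : ℕ × ℕ, IsProbabilityMeasure (Ω n.1 n.2) := fun n ↦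
    (Measure.isProbabilityMeasure_map_iff measurable_fst.aemeasurable).1
      (by rw [(hΩ n.1 n.2).1]; infer_instance)
  -- On a countable index set any choice of couplings is measurable; the dependence on `x` enters
  -- only through `N₁` and `N₂`.
  let κ₀ : Kernel (ℕ × ℕ) (I × I) := Kernel.ofFunOfCountable fun n ↦ Ω n.1 n.2
  have : IsMarkovKernel κ₀ := ⟨hprob⟩
  let κ : Kernel (Eu d) (I × I) := κ₀.comap (fun x ↦ (N₁ x, N₂ x)) (by fun_prop)
  have hκ : ∀ x, κ x = Ω (N₁ x) (N₂ x) := fun x ↦ rfl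
  have hm₁ : Measurable fun q : Eu d × I × I ↦ T₁ q.1 q.2.1 :=
    hT₁.comp (measurable_fst.prodMk (measurable_fst.comp measurable_snd))
  have hm₂ : Measurable fun q : Eu d × I × I ↦ T₂ q.1 q.2.2 :=
    hT₂.comp (measurable_fst.prodMk (measurable_snd.comp measurable_snd))
  have hm : Measurable fun q : Eu d × I × I ↦ (q.1, T₁ q.1 q.2.1, T₂ q.1 q.2.2) :=
    measurable_fst.prodMk (hm₁.prodMk hm₂)
  let β : ProbabilityMeasure (Eu d × I × I) := ⟨(ϱ : Measure (Eu d)) ⊗ₘ κ, inferInstance⟩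
  let α : ProbabilityMeasure (Eu d × Eu d × Eu d) := β.map hm.aemeasurable
  have hα : (α : Measure (Eu d × Eu d × Eu d)) = ((ϱ : Measure (Eu d)) ⊗ₘ κ).map
      (fun q : Eu d × I × I ↦ (q.1, T₁ q.1 q.2.1, T₂ q.1 q.2.2)) := rfl
  have hmT₁ : ∀ x, Measurable (T₁ x) := fun x ↦ hT₁.comp measurable_prodMk_left
  have hmT₂ : ∀ x, Measurable (T₂ x) := fun x ↦ hT₂.comp measurable_prodMk_left
  have hadm : α ∈ Adm γ₁ γ₂ := by
    refine mem_adm_of_map hγ₁.1 hγ₂.1 ?_ ?_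
    · rw [← Plans.disintegrate hγ₁, hα, Measure.map_map (by fun_prop) hm]
      refine Measure.ext_of_lintegral _ fun f hf ↦ ?_
      rw [lintegral_map hf (by fun_prop), Measure.lintegral_compProd (by fun_prop),
        Measure.lintegral_compProd hf]
      refine lintegral_congr fun x ↦ ?_
      rw [← hT₁' x, hκ, lintegral_map (by fun_prop) (hmT₁ x)]
      conv_rhs => rw [← (hΩ (N₁ x) (N₂ x)).1]
      rw [lintegral_map (by fun_prop) (by fun_prop)]
      rfl
    · rw [← Plans.disintegrate hγ₂, hα, Measure.map_map (by fun_prop) hm]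
      refine Measure.ext_of_lintegral _ fun f hf ↦ ?_
      rw [lintegral_map hf (by fun_prop), Measure.lintegral_compProd (by fun_prop),
        Measure.lintegral_compProd hf]
      refine lintegral_congr fun x ↦ ?_
      rw [← hT₂' x, hκ, lintegral_map (by fun_prop) (hmT₂ x)]
      conv_rhs => rw [← (hΩ (N₁ x) (N₂ x)).2]
      rw [lintegral_map (by fun_prop) (by fun_prop)]
      rfl
  refine ⟨α, hadm, ?_⟩
  let V : Eu d → ℝ≥0∞ := fun x ↦ liftCost (κ x) (T₁ x) (T₂ x)
  have hV : Measurable V := by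
    simp only [V, liftCost, eLpNorm_two]
    refine Measurable.pow_const ?_ _
    exact Measurable.lintegral_kernel_prod_right'
      (f := fun q : Eu d × I × I ↦ ‖T₁ q.1 q.2.1 - T₂ q.1 q.2.2‖ₑ ^ 2) (by fun_prop)
  have hcost : ∫⁻ p, ‖p.2.1 - p.2.2‖ₑ ^ 2 ∂(α : Measure (Eu d × Eu d × Eu d)) =
      ∫⁻ x, V x ^ 2 ∂(ϱ : Measure (Eu d)) := by
    rw [hα, lintegral_map (by fun_prop) hm, Measure.lintegral_compProd (by fun_prop)]
    refine lintegral_congr fun x ↦ ?_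
    rw [← eLpNorm_two_sq]
    rfl
  have hVW : ∀ᵐ x ∂(ϱ : Measure (Eu d)),
      V x ≤ wasserstein (fibre γ₁ x) (fibre γ₂ x) + 5 * ε := by
    filter_upwards [Plans.ae_fibre_lt_top hγ₁, Plans.ae_fibre_lt_top hγ₂] with x hx₁ hx₂
    have a₁ : eLpNorm (T₁ x - ⇑(G (N₁ x))) 2 volume ≤ ε := by
      refine hN₁' x fun h ↦ ?_
      rw [fibre, ← hT₁', lintegral_map (by fun_prop) (hmT₁ x), ← eLpNorm_two_sq, h] at hx₁
      simp at hx₁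
    have a₂ : eLpNorm (T₂ x - ⇑(G (N₂ x))) 2 volume ≤ ε := by
      refine hN₂' x fun h ↦ ?_
      rw [fibre, ← hT₂', lintegral_map (by fun_prop) (hmT₂ x), ← eLpNorm_two_sq, h] at hx₂
      simp at hx₂
    have key : ∀ π : Measure (Eu d × Eu d), π.map Prod.fst = fibre γ₁ x →
        π.map Prod.snd = fibre γ₂ x →
        V x ≤ (∫⁻ z, ‖z.1 - z.2‖ₑ ^ 2 ∂π) ^ (1 / 2 : ℝ) + 5 * ε := by
      intro π h₁ h₂
      rw [fibre, ← hT₁'] at h₁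
      rw [fibre, ← hT₂'] at h₂
      obtain ⟨ω, hω₁, hω₂, rfl⟩ := exists_coupling_lift volume (hmT₁ x) (hmT₂ x) π h₁ h₂
      have hc : (∫⁻ z, ‖z.1 - z.2‖ₑ ^ 2 ∂ω.map (fun z ↦ (T₁ x z.1, T₂ x z.2))) ^ (1 / 2 : ℝ) =
          liftCost ω (T₁ x) (T₂ x) := by
        have := hmT₁ x
        have := hmT₂ x
        rw [lintegral_map (by fun_prop) (by fun_prop), liftCost, eLpNorm_two]
      rw [hc]
      have s₁ := (hmT₁ x).stronglyMeasurable
      have s₂ := (hmT₂ x).stronglyMeasurable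
      have g₁ := Lp.stronglyMeasurable (G (N₁ x))
      have g₂ := Lp.stronglyMeasurable (G (N₂ x))
      calc V x ≤ ε + liftCost (κ x) (G (N₁ x)) (G (N₂ x)) + ε :=
            (liftCost_triangle (hΩ _ _).1 (hΩ _ _).2 s₁ s₂ g₁ g₂).trans
              (add_le_add_left (add_le_add_left a₁ _) _ |>.trans (add_le_add_right a₂ _))
        _ ≤ ε + (liftCost ω (G (N₁ x)) (G (N₂ x)) + ε) + ε := by
            gcongr; exact hΩ' _ _ ω hω₁ hω₂
        _ ≤ ε + ((ε + liftCost ω (T₁ x) (T₂ x) + ε) + ε) + ε := by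
            gcongr
            refine (liftCost_triangle hω₁ hω₂ g₁ g₂ s₁ s₂).trans ?_
            gcongr
            · rwa [eLpNorm_sub_comm]
            · rwa [eLpNorm_sub_comm]
        _ = _ := by ring
    rw [← tsub_le_iff_right]
    rw [wasserstein, ← ENNReal.rpow_le_rpow_iff (z := 2) (by norm_num), ← ENNReal.rpow_mul]
    norm_num
    intro π h₁ h₂
    have := tsub_le_iff_right.2 (key π h₁ h₂)
    calc (V x - 5 * ε) ^ 2 ≤ ((∫⁻ z, ‖z.1 - z.2‖ₑ ^ 2 ∂π) ^ (1 / 2 : ℝ)) ^ 2 := by gcongr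
      _ = _ := rpow_half_sq _
  -- Minkowski's inequality is applied to this measurable minorant of the fibrewise distance, so no
  -- measurability of `x ↦ W(γ¹_x, γ²_x)` is needed.
  let U : Eu d → ℝ≥0∞ := fun x ↦ V x - 5 * ε
  have hU : Measurable U := by fun_prop
  calc _ = (∫⁻ x, V x ^ (2 : ℝ) ∂(ϱ : Measure (Eu d))) ^ (1 / 2 : ℝ) := by
        rw [hcost]; simp
    _ ≤ (∫⁻ x, (U + fun _ : Eu d ↦ 5 * ε : Eu d → ℝ≥0∞) x ^ (2 : ℝ)
          ∂(ϱ : Measure (Eu d))) ^ (1 / 2 : ℝ) := by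
        gcongr with x
        exact tsub_le_iff_right.1 le_rfl
    _ ≤ (∫⁻ x, U x ^ (2 : ℝ) ∂(ϱ : Measure (Eu d))) ^ (1 / 2 : ℝ) +
        (∫⁻ _, (5 * ε) ^ (2 : ℝ) ∂(ϱ : Measure (Eu d))) ^ (1 / 2 : ℝ) :=
        ENNReal.lintegral_Lp_add_le hU.aemeasurable aemeasurable_const (by norm_num)
    _ ≤ fibreDist ϱ γ₁ γ₂ + 5 * ε := by
        gcongr
        · rw [fibreDist]
          refine ENNReal.rpow_le_rpow (lintegral_mono_ae ?_) (by norm_num)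
          filter_upwards [hVW] with x hx
          rw [ENNReal.rpow_ofNat]
          gcongr
          exact tsub_le_iff_right.2 hx
        · rw [lintegral_const, measure_univ, mul_one, ← ENNReal.rpow_mul]
          norm_num

/-! ### Barycentric projection. -/

lemma memLp_two_of_lintegral_lt_top {X F : Type*} [MeasurableSpace X] [NormedAddCommGroup F]
    {f : X → F} {μ : Measure X} (hf : AEStronglyMeasurable f μ) (h : ∫⁻ x, ‖f x‖ₑ ^ 2 ∂μ < ∞) :
    MemLp f 2 μ := by
  rw [← eLpNorm_two_sq] at h
  exact ⟨hf, (ENNReal.pow_lt_top_iff.1 h).resolve_right (by norm_num)⟩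

/-- Bias-variance decomposition. -/
lemma lintegral_sub_sq_eq {d : ℕ} {ν : Measure (Eu d)} [IsProbabilityMeasure ν]
    (hν : ∫⁻ y, ‖y‖ₑ ^ 2 ∂ν < ∞) (a : Eu d) :
    ∫⁻ y, ‖a - y‖ₑ ^ 2 ∂ν =
      ‖a - ∫ y, y ∂ν‖ₑ ^ 2 + ∫⁻ y, ‖(∫ y, y ∂ν) - y‖ₑ ^ 2 ∂ν := by
  have hid : MemLp (fun y : Eu d ↦ y) 2 ν :=
    memLp_two_of_lintegral_lt_top (by fun_prop) hν
  have hint : Integrable (fun y : Eu d ↦ y) ν := hid.integrable (by norm_num)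
  set b := ∫ y, y ∂ν with hb
  have conv : ∀ c : Eu d, ∫⁻ y, ‖c - y‖ₑ ^ 2 ∂ν = ENNReal.ofReal (∫ y, ‖c - y‖ ^ 2 ∂ν) := by
    intro c
    have hc : MemLp (fun y : Eu d ↦ c - y) 2 ν := (memLp_const c).sub hid
    rw [ofReal_integral_eq_lintegral_ofReal hc.integrable_norm_pow'
      (ae_of_all _ fun _ ↦ by positivity)]
    refine lintegral_congr fun y ↦ ?_
    rw [ENNReal.ofReal_pow (norm_nonneg _), ofReal_norm]
  have hbc : MemLp (fun y : Eu d ↦ b - y) 2 ν := (memLp_const b).sub hid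
  rw [conv, conv, ← ofReal_norm, ← ENNReal.ofReal_pow (norm_nonneg _),
    ← ENNReal.ofReal_add (by positivity) (integral_nonneg fun _ ↦ by positivity)]
  congr 1
  have hexp : ∀ y : Eu d, ‖a - y‖ ^ 2 =
      ‖a - b‖ ^ 2 + 2 * inner ℝ (a - b) (b - y) + ‖b - y‖ ^ 2 := by
    intro y
    rw [← norm_add_sq_real]; congr 2; abel
  have hbi : Integrable (fun y : Eu d ↦ b - y) ν := (integrable_const b).sub hint
  have hinner : Integrable (fun y : Eu d ↦ 2 * inner ℝ (a - b) (b - y)) ν :=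
    (hbi.const_inner (a - b)).const_mul 2
  have hsum : Integrable (fun y : Eu d ↦ ‖a - b‖ ^ 2 + 2 * inner ℝ (a - b) (b - y)) ν :=
    (integrable_const _).add hinner
  rw [integral_congr_ae (ae_of_all ν hexp), integral_add hsum hbc.integrable_norm_pow',
    integral_add (integrable_const _) hinner, integral_const_mul, integral_inner hbi,
    integral_sub (integrable_const _) hint, ← hb, integral_const, integral_const, probReal_univ,
    one_smul, one_smul, sub_self, inner_zero_right, mul_zero, add_zero]

/-- The plan `(x, Z)#υ`. -/
def graphPlan {d : ℕ} (υ : ProbabilityMeasure (Eu d × Eu d))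
    (Z : Lp (Eu d) 2 (υ : Measure (Eu d × Eu d))) : ProbabilityMeasure (Eu d × Eu d) :=
  υ.map (f := fun p ↦ (p.1, Z p))
    (measurable_fst.prodMk (Lp.stronglyMeasurable Z).measurable).aemeasurable

lemma graphPlan_mem_plans {d : ℕ} {ϱ : ProbabilityMeasure (Eu d)}
    {υ : ProbabilityMeasure (Eu d × Eu d)} (hυ : υ ∈ Plans ϱ)
    (Z : Lp (Eu d) 2 (υ : Measure (Eu d × Eu d))) : graphPlan υ Z ∈ Plans ϱ := by
  have hZ := (Lp.stronglyMeasurable Z).measurable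
  constructor
  · rw [FiniteSecondMoment, graphPlan, ProbabilityMeasure.toMeasure_map,
      lintegral_map (by fun_prop) (by fun_prop)]
    have h := ENNReal.add_lt_top.2 ⟨hυ.1, (ENNReal.pow_lt_top (Lp.eLpNorm_lt_top Z) : _ ^ 2 < ∞)⟩
    refine lt_of_le_of_lt ?_ h
    rw [eLpNorm_two_sq, ← lintegral_add_left (by fun_prop)]
    refine lintegral_mono fun p ↦ ?_
    have : ‖(p.1, Z p)‖ₑ ≤ ‖p‖ₑ ∨ ‖(p.1, Z p)‖ₑ ≤ ‖Z p‖ₑ := by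
      simp only [enorm_le_iff_norm_le, Prod.norm_def]
      grind
    rcases this with h | h
    · exact le_add_right (by gcongr)
    · exact le_add_left (by gcongr)
  · rw [graphPlan, ProbabilityMeasure.toMeasure_map,
      Measure.map_map (by fun_prop) (by fun_prop), ← hυ.2]
    rfl

/-- The complement of the set is the countable union, over basic open sets `B`, of `{x | γ_x(B) = 0}
× B`; full measure then follows fibre by fibre. -/
lemma ae_mem_support_fibre {d : ℕ} {ϱ : ProbabilityMeasure (Eu d)}
    {γ : ProbabilityMeasure (Eu d × Eu d)} (hγ : γ ∈ Plans ϱ) :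
    MeasurableSet {p : Eu d × Eu d | p.2 ∈ (fibre γ p.1).support} ∧
      ∀ᵐ p ∂(γ : Measure (Eu d × Eu d)), p.2 ∈ (fibre γ p.1).support := by
  have hmeas : MeasurableSet {p : Eu d × Eu d | p.2 ∈ (fibre γ p.1).support} := by
    have h : {p : Eu d × Eu d | p.2 ∈ (fibre γ p.1).support}ᶜ =
        ⋃ B ∈ TopologicalSpace.countableBasis (Eu d), {x | fibre γ x B = 0} ×ˢ B := by
      ext ⟨x, y⟩
      simp only [Set.mem_compl_iff, Set.mem_ofPred_eq, Set.mem_iUnion, Set.mem_prod, exists_prop]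
      rw [((TopologicalSpace.isBasis_countableBasis (Eu d)).nhds_hasBasis).notMem_measureSupport]
      constructor
      · rintro ⟨B, ⟨hB, hy⟩, h0⟩; exact ⟨B, hB, h0, hy⟩
      · rintro ⟨B, hB, h0, hy⟩; exact ⟨B, ⟨hB, hy⟩, h0⟩
    rw [← MeasurableSet.compl_iff, h]
    refine MeasurableSet.biUnion (TopologicalSpace.countable_countableBasis _) fun B hB ↦ ?_
    have hB' := (TopologicalSpace.isOpen_of_mem_countableBasis hB).measurableSet
    exact ((Kernel.measurable_coe _ hB') (measurableSet_singleton 0)).prod hB'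
  refine ⟨hmeas, ?_⟩
  have : ∀ᵐ p ∂((ϱ : Measure (Eu d)) ⊗ₘ (γ : Measure (Eu d × Eu d)).condKernel),
      p.2 ∈ (fibre γ p.1).support := by
    rw [Measure.ae_compProd_iff hmeas]
    exact ae_of_all _ fun x ↦ Measure.support_mem_ae
  rwa [Plans.disintegrate hγ] at this

/-- Barycentric projection of an admissible plan onto its first two components. -/
lemma exists_barycentre {d : ℕ} {ϱ : ProbabilityMeasure (Eu d)}
    {C : Set (ProbabilityMeasure (Eu d × Eu d))} (hCom : HullStable ϱ C)
    {υ η : ProbabilityMeasure (Eu d × Eu d)} (hυ : υ ∈ Plans ϱ) (hη : η ∈ Plans ϱ) (hηC : η ∈ C)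
    {α : ProbabilityMeasure (Eu d × Eu d × Eu d)} (hα : α ∈ Adm υ η) :
    ∃ Z : Lp (Eu d) 2 (υ : Measure (Eu d × Eu d)), graphPlan υ Z ∈ C ∧
      ∫⁻ p, ‖p.2.1 - p.2.2‖ₑ ^ 2 ∂(α : Measure (Eu d × Eu d × Eu d)) =
        ∫⁻ q, ‖q.2 - Z q‖ₑ ^ 2 ∂(υ : Measure (Eu d × Eu d)) +
        ∫⁻ p, ‖Z (p.1, p.2.1) - p.2.2‖ₑ ^ 2 ∂(α : Measure (Eu d × Eu d × Eu d)) := by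
  let A : Measure ((Eu d × Eu d) × Eu d) :=
    (α : Measure (Eu d × Eu d × Eu d)).map (fun p ↦ ((p.1, p.2.1), p.2.2))
  have : IsProbabilityMeasure A := Measure.isProbabilityMeasure_map (by fun_prop)
  let k : Kernel (Eu d × Eu d) (Eu d) := A.condKernel
  have hAk : (υ : Measure (Eu d × Eu d)) ⊗ₘ k = A := by
    have : A.fst = υ := by
      rw [← hα.2.1, Measure.fst, Measure.map_map (by fun_prop) (by fun_prop)]; rfl
    rw [← this]; exact Measure.disintegrate _ _
  have hαA : ∀ f : (Eu d × Eu d) × Eu d → ℝ≥0∞, Measurable f →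
      ∫⁻ p, f ((p.1, p.2.1), p.2.2) ∂(α : Measure (Eu d × Eu d × Eu d)) =
        ∫⁻ q, ∫⁻ y, f (q, y) ∂k q ∂(υ : Measure (Eu d × Eu d)) := by
    intro f hf
    rw [← Measure.lintegral_compProd hf, hAk, lintegral_map hf (by fun_prop)]
  have hmom : ∫⁻ q, ∫⁻ y, ‖y‖ₑ ^ 2 ∂k q ∂(υ : Measure (Eu d × Eu d)) < ∞ := by
    rw [← hαA (fun z ↦ ‖z.2‖ₑ ^ 2) (by fun_prop)]
    have := lintegral_snd_sq_lt_top hη.1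
    rwa [← hα.2.2, lintegral_map (by fun_prop) (by fun_prop)] at this
  have hfin : ∀ᵐ q ∂(υ : Measure (Eu d × Eu d)), ∫⁻ y, ‖y‖ₑ ^ 2 ∂k q < ∞ :=
    ae_lt_top (Measurable.lintegral_kernel (by fun_prop)) hmom.ne
  have hmeas : StronglyMeasurable fun q ↦ ∫ y, y ∂k q :=
    StronglyMeasurable.integral_kernel_prod_right' (f := Prod.snd)
      measurable_snd.stronglyMeasurable
  have hL : MemLp (fun q ↦ ∫ y, y ∂k q) 2 (υ : Measure (Eu d × Eu d)) := by
    refine memLp_two_of_lintegral_lt_top hmeas.aestronglyMeasurable ?_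
    refine lt_of_le_of_lt (lintegral_mono_ae ?_) hmom
    filter_upwards [hfin] with q hq
    -- Bias-variance at `a = 0` bounds the squared norm of the mean by the second moment.
    have := lintegral_sub_sq_eq hq 0
    simp only [zero_sub, enorm_neg] at this
    rw [this]
    exact le_self_add
  set Z := hL.toLp _
  have hZ : ∀ᵐ q ∂(υ : Measure (Eu d × Eu d)), Z q = ∫ y, y ∂k q := hL.coeFn_toLp
  have hZm := (Lp.stronglyMeasurable Z).measurable
  refine ⟨Z, ?_, ?_⟩
  · refine hCom _ (graphPlan_mem_plans hυ Z) η hηC ?_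
    obtain ⟨hS, hSae⟩ := ae_mem_support_fibre hη
    rw [← hα.2.2, ae_map_iff (by fun_prop) hS] at hSae
    have h₁ : ∀ᵐ z ∂((υ : Measure (Eu d × Eu d)) ⊗ₘ k), z.2 ∈ (fibre η z.1.1).support := by
      rw [hAk]
      exact (ae_map_iff (by fun_prop)
        (hS.preimage (f := fun z : (Eu d × Eu d) × Eu d ↦ (z.1.1, z.2)) (by fun_prop))).2 hSae
    have h₂ : ∀ᵐ q ∂(υ : Measure (Eu d × Eu d)),
        Z q ∈ closedConvexHull ℝ (fibre η q.1).support := by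
      filter_upwards [Measure.ae_ae_of_ae_compProd h₁, hZ, hfin] with q hq hZq hfq
      rw [hZq]
      refine Convex.integral_mem (convex_closedConvexHull) (isClosed_closedConvexHull) ?_ ?_
      · filter_upwards [hq] with y hy
        exact subset_closedConvexHull hy
      · have : MemLp (fun y : Eu d ↦ y) 2 (k q) :=
          memLp_two_of_lintegral_lt_top (by fun_prop) hfq
        exact this.integrable (by norm_num)
    have h₂' : ∀ᵐ q ∂((ϱ : Measure (Eu d)) ⊗ₘ (υ : Measure (Eu d × Eu d)).condKernel),
        Z q ∈ closedConvexHull ℝ (fibre η q.1).support := by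
      rwa [Plans.disintegrate hυ]
    have h₃ := ae_fibre_eq_map (ϱ : Measure (Eu d)) (υ : Measure (Eu d × Eu d)).condKernel
      (g := Z) hZm (graphPlan υ Z) (by rw [Plans.disintegrate hυ]; rfl)
    filter_upwards [Measure.ae_ae_of_ae_compProd h₂', h₃] with x hx hx₃
    rw [hx₃]
    refine Measure.support_subset_of_isClosed isClosed_closedConvexHull ?_
    exact (ae_map_iff (by fun_prop) isClosed_closedConvexHull.measurableSet).2 hx
  · rw [hαA (fun z ↦ ‖z.1.2 - z.2‖ₑ ^ 2) (by fun_prop),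
      hαA (fun z ↦ ‖Z z.1 - z.2‖ₑ ^ 2) (by fun_prop), ← lintegral_add_left (by fun_prop)]
    refine lintegral_congr_ae ?_
    filter_upwards [hZ, hfin] with q hq hfq
    rw [hq]
    exact lintegral_sub_sq_eq hfq q.2

/-! ### Plans at vanishing transport cost coincide. -/

/-- Mass of `F` that is not sent into its `r`-thickening moves by at least `r`, so by Markov's
inequality a cost `δ r²` allows at most `δ` of it. Let `δ → 0`, then `r → 0`. -/
lemma measure_le_of_couplings {X : Type*} [PseudoEMetricSpace X] [SecondCountableTopology X]
    [MeasurableSpace X] [BorelSpace X] {μ ν : Measure X} [IsFiniteMeasure ν]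
    (h : ∀ δ : ℝ≥0∞, δ ≠ 0 → ∃ β : Measure (X × X), β.map Prod.fst = μ ∧ β.map Prod.snd = ν ∧
      ∫⁻ z, edist z.1 z.2 ^ 2 ∂β ≤ δ) {F : Set X} (hF : IsClosed F) : μ F ≤ ν F := by
  have key : ∀ r : ℝ, 0 < r → μ F ≤ ν (Metric.thickening r F) := by
    intro r hr
    refine ENNReal.le_of_forall_pos_le_add fun δ hδ _ ↦ ?_
    have hr' : ENNReal.ofReal r ^ 2 ≠ 0 := by simpa using hr
    have hr'' : ENNReal.ofReal r ^ 2 ≠ ∞ := by simp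
    have hδ' : (δ : ℝ≥0∞) ≠ 0 := by simpa using hδ.ne'
    obtain ⟨β, h₁, h₂, h₃⟩ := h (δ * ENNReal.ofReal r ^ 2) (mul_ne_zero hδ' hr')
    have hsub : Prod.fst ⁻¹' F ⊆ Prod.snd ⁻¹' Metric.thickening r F ∪
        {z : X × X | ENNReal.ofReal r ^ 2 ≤ edist z.1 z.2 ^ 2} := by
      intro z hz
      by_cases hzr : ENNReal.ofReal r ≤ edist z.1 z.2
      · right
        change ENNReal.ofReal r ^ 2 ≤ edist z.1 z.2 ^ 2
        gcongr
      · left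
        rw [Set.mem_preimage, Metric.mem_thickening_iff_infEDist_lt]
        refine lt_of_le_of_lt (Metric.infEDist_le_edist_of_mem hz) ?_
        rw [edist_comm]
        exact not_le.1 hzr
    calc μ F = β (Prod.fst ⁻¹' F) := by
          rw [← h₁, Measure.map_apply measurable_fst hF.measurableSet]
      _ ≤ β (Prod.snd ⁻¹' Metric.thickening r F) +
          β {z : X × X | ENNReal.ofReal r ^ 2 ≤ edist z.1 z.2 ^ 2} :=
          (measure_mono hsub).trans (measure_union_le _ _)
      _ ≤ ν (Metric.thickening r F) + δ := by
          gcongr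
          · rw [← h₂, Measure.map_apply measurable_snd Metric.isOpen_thickening.measurableSet]
          · refine (meas_ge_le_lintegral_div (by fun_prop) hr' hr'').trans ?_
            exact ENNReal.div_le_of_le_mul h₃
  refine ge_of_tendsto (tendsto_measure_thickening_of_isClosed
    ⟨1, one_pos, measure_ne_top ν _⟩ hF) ?_
  filter_upwards [self_mem_nhdsWithin] with r hr using key r hr

/-- Plans joined by admissible plans of arbitrarily small cost coincide. -/
lemma eq_of_forall_exists_adm {d : ℕ} {γ₁ γ₂ : ProbabilityMeasure (Eu d × Eu d)}
    (h : ∀ δ : ℝ≥0∞, δ ≠ 0 → ∃ α ∈ Adm γ₁ γ₂,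
      ∫⁻ p, ‖p.2.1 - p.2.2‖ₑ ^ 2 ∂(α : Measure (Eu d × Eu d × Eu d)) ≤ δ) : γ₁ = γ₂ := by
  have h₁ : ∀ F : Set (Eu d × Eu d), IsClosed F →
      (γ₁ : Measure (Eu d × Eu d)) F ≤ (γ₂ : Measure (Eu d × Eu d)) F := by
    intro F hF
    refine measure_le_of_couplings (fun δ hδ ↦ ?_) hF
    obtain ⟨α, hα, hc⟩ := h δ hδ
    refine ⟨(α : Measure (Eu d × Eu d × Eu d)).map (fun p ↦ ((p.1, p.2.1), (p.1, p.2.2))),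
      ?_, ?_, ?_⟩
    · rw [Measure.map_map (by fun_prop) (by fun_prop), ← hα.2.1]; rfl
    · rw [Measure.map_map (by fun_prop) (by fun_prop), ← hα.2.2]; rfl
    · rw [lintegral_map (by fun_prop) (by fun_prop)]
      simp only [Prod.edist_eq, edist_self, zero_le, sup_of_le_right]
      simpa only [edist_eq_enorm_sub] using hc
  have h₂ : ∀ F : Set (Eu d × Eu d), IsClosed F →
      (γ₂ : Measure (Eu d × Eu d)) F ≤ (γ₁ : Measure (Eu d × Eu d)) F := by
    intro F hF
    refine measure_le_of_couplings (fun δ hδ ↦ ?_) hF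
    obtain ⟨α, hα, hc⟩ := h δ hδ
    refine ⟨(α : Measure (Eu d × Eu d × Eu d)).map (fun p ↦ ((p.1, p.2.2), (p.1, p.2.1))),
      ?_, ?_, ?_⟩
    · rw [Measure.map_map (by fun_prop) (by fun_prop), ← hα.2.2]; rfl
    · rw [Measure.map_map (by fun_prop) (by fun_prop), ← hα.2.1]; rfl
    · rw [lintegral_map (by fun_prop) (by fun_prop)]
      simp only [Prod.edist_eq, edist_self, zero_le, sup_of_le_right]
      simpa only [edist_comm, edist_eq_enorm_sub] using hc
  refine Subtype.ext (ext_of_generate_finite (μ := (γ₁ : Measure (Eu d × Eu d)))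
    (ν := (γ₂ : Measure (Eu d × Eu d))) {s | IsClosed s} ?_ isPiSystem_isClosed
    (fun F hF ↦ le_antisymm (h₁ F hF) (h₂ F hF)) (by simp))
  rw [BorelSpace.measurable_eq (α := Eu d × Eu d), borel_eq_generateFrom_isClosed]

/-! ### Plans induced by maps and the projection in `L²(υ)`. -/

/-- The plan `(x, Z₁, Z₂)#υ`. -/
def pairPlan {d : ℕ} (υ : ProbabilityMeasure (Eu d × Eu d))
    (Z₁ Z₂ : Lp (Eu d) 2 (υ : Measure (Eu d × Eu d))) : ProbabilityMeasure (Eu d × Eu d × Eu d) :=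
  υ.map (f := fun p ↦ (p.1, Z₁ p, Z₂ p))
    (measurable_fst.prodMk ((Lp.stronglyMeasurable Z₁).measurable.prodMk
      (Lp.stronglyMeasurable Z₂).measurable)).aemeasurable

lemma enorm_sub_sq_le {F : Type*} [NormedAddCommGroup F] (a b c : F) :
    ‖a - c‖ₑ ^ 2 ≤ 2 * (‖b - a‖ₑ ^ 2 + ‖b - c‖ₑ ^ 2) := by
  have h : ‖a - c‖₊ ≤ ‖b - a‖₊ + ‖b - c‖₊ := by
    have := nnnorm_sub_le (b - c) (b - a)
    rwa [sub_sub_sub_cancel_left, add_comm] at this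
  have h' : ‖a - c‖₊ ^ 2 ≤ 2 * (‖b - a‖₊ ^ 2 + ‖b - c‖₊ ^ 2) :=
    (pow_le_pow_left' h 2).trans add_sq_le
  simp only [enorm]
  exact_mod_cast h'

section

variable {d : ℕ} {ϱ : ProbabilityMeasure (Eu d)} {C : Set (ProbabilityMeasure (Eu d × Eu d))}
  {υ : ProbabilityMeasure (Eu d × Eu d)}

lemma Adm.map_left {η : ProbabilityMeasure (Eu d × Eu d)}
    {α : ProbabilityMeasure (Eu d × Eu d × Eu d)} (hα : α ∈ Adm υ η) {X : Type*}
    [MeasurableSpace X] {f : Eu d × Eu d → X} (hf : Measurable f) :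
    (υ : Measure (Eu d × Eu d)).map f =
      (α : Measure (Eu d × Eu d × Eu d)).map (fun p ↦ f (p.1, p.2.1)) := by
  rw [← hα.2.1, Measure.map_map hf (by fun_prop)]
  rfl

lemma Adm.lintegral_left {η : ProbabilityMeasure (Eu d × Eu d)}
    {α : ProbabilityMeasure (Eu d × Eu d × Eu d)} (hα : α ∈ Adm υ η)
    {f : Eu d × Eu d → ℝ≥0∞} (hf : Measurable f) :
    ∫⁻ q, f q ∂(υ : Measure (Eu d × Eu d)) =
      ∫⁻ p, f (p.1, p.2.1) ∂(α : Measure (Eu d × Eu d × Eu d)) := by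
  rw [← hα.2.1, lintegral_map hf (by fun_prop)]

lemma pairPlan_mem_adm (hυ : υ ∈ Plans ϱ) (Z₁ Z₂ : Lp (Eu d) 2 (υ : Measure (Eu d × Eu d))) :
    pairPlan υ Z₁ Z₂ ∈ Adm (graphPlan υ Z₁) (graphPlan υ Z₂) := by
  have h₁ := (Lp.stronglyMeasurable Z₁).measurable
  have h₂ := (Lp.stronglyMeasurable Z₂).measurable
  refine mem_adm_of_map (graphPlan_mem_plans hυ Z₁).1 (graphPlan_mem_plans hυ Z₂).1
    ?_ ?_ <;>
  · rw [pairPlan, graphPlan, ProbabilityMeasure.toMeasure_map, ProbabilityMeasure.toMeasure_map,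
      Measure.map_map (by fun_prop) (by fun_prop)]
    rfl

lemma lintegral_sub_sq_Lp (Z₁ Z₂ : Lp (Eu d) 2 (υ : Measure (Eu d × Eu d))) :
    ∫⁻ q, ‖Z₁ q - Z₂ q‖ₑ ^ 2 ∂(υ : Measure (Eu d × Eu d)) = ‖Z₁ - Z₂‖ₑ ^ 2 := by
  rw [Lp.enorm_def, eLpNorm_two_sq]
  refine lintegral_congr_ae ?_
  filter_upwards [Lp.coeFn_sub Z₁ Z₂] with q hq
  rw [hq, Pi.sub_apply]

lemma lintegral_pairPlan (Z₁ Z₂ : Lp (Eu d) 2 (υ : Measure (Eu d × Eu d))) :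
    ∫⁻ p, ‖p.2.1 - p.2.2‖ₑ ^ 2 ∂(pairPlan υ Z₁ Z₂ : Measure (Eu d × Eu d × Eu d)) =
      ‖Z₁ - Z₂‖ₑ ^ 2 := by
  have h₁ := (Lp.stronglyMeasurable Z₁).measurable
  have h₂ := (Lp.stronglyMeasurable Z₂).measurable
  rw [pairPlan, ProbabilityMeasure.toMeasure_map, lintegral_map (by fun_prop) (by fun_prop),
    lintegral_sub_sq_Lp]

lemma fibreDist_graphPlan_le (hυ : υ ∈ Plans ϱ)
    (Z₁ Z₂ : Lp (Eu d) 2 (υ : Measure (Eu d × Eu d))) :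
    fibreDist ϱ (graphPlan υ Z₁) (graphPlan υ Z₂) ≤ ‖Z₁ - Z₂‖ₑ := by
  rw [← ENNReal.pow_le_pow_left_iff (two_ne_zero), ← lintegral_pairPlan]
  exact fibreDist_sq_le (graphPlan_mem_plans hυ Z₁) (pairPlan_mem_adm hυ Z₁ Z₂)

lemma graphPlan_congr {Z : Lp (Eu d) 2 (υ : Measure (Eu d × Eu d))}
    {f : Eu d × Eu d → Eu d} (h : Z =ᵐ[(υ : Measure (Eu d × Eu d))] f) :
    (graphPlan υ Z : Measure (Eu d × Eu d)) =
      (υ : Measure (Eu d × Eu d)).map (fun p ↦ (p.1, f p)) := by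
  rw [graphPlan, ProbabilityMeasure.toMeasure_map]
  refine Measure.map_congr ?_
  filter_upwards [h] with p hp
  rw [hp]

lemma graphPlan_smul (s : ℝ) (Z : Lp (Eu d) 2 (υ : Measure (Eu d × Eu d))) :
    graphPlan υ (s • Z) = scale s (graphPlan υ Z) := by
  have h := (Lp.stronglyMeasurable Z).measurable
  apply Subtype.ext
  refine (graphPlan_congr (Lp.coeFn_smul s Z)).trans ?_
  change _ = Measure.map _ (Measure.map _ _)
  rw [Measure.map_map (by fun_prop) (by fun_prop)]
  rfl

lemma graphPlan_add (Z₁ Z₂ : Lp (Eu d) 2 (υ : Measure (Eu d × Eu d))) :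
    graphPlan υ (Z₁ + Z₂) =
      (pairPlan υ Z₁ Z₂).map (f := fun p ↦ (p.1, p.2.1 + p.2.2)) (by fun_prop) := by
  have h₁ := (Lp.stronglyMeasurable Z₁).measurable
  have h₂ := (Lp.stronglyMeasurable Z₂).measurable
  apply Subtype.ext
  refine (graphPlan_congr (Lp.coeFn_add Z₁ Z₂)).trans ?_
  change _ = Measure.map _ (Measure.map _ _)
  rw [Measure.map_map (by fun_prop) (by fun_prop)]
  rfl

lemma convex_graphPlan_mem (hC : IsClosedConvex ϱ C) (hυ : υ ∈ Plans ϱ) :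
    Convex ℝ {Z : Lp (Eu d) 2 (υ : Measure (Eu d × Eu d)) | graphPlan υ Z ∈ C} := by
  intro Z₁ h₁ Z₂ h₂ a b ha hb hab
  refine hC.convex _ h₁ _ h₂ b ⟨hb, by linarith⟩ ⟨pairPlan υ (a • Z₁) (b • Z₂), ?_, ?_⟩
  · rw [← graphPlan_smul, ← graphPlan_smul, show 1 - b = a by linarith]
    exact pairPlan_mem_adm hυ _ _
  · exact graphPlan_add _ _

lemma isClosed_graphPlan_mem (hC : IsClosedConvex ϱ C) (hυ : υ ∈ Plans ϱ) :
    IsClosed {Z : Lp (Eu d) 2 (υ : Measure (Eu d × Eu d)) | graphPlan υ Z ∈ C} := by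
  refine IsSeqClosed.isClosed fun Z Z' hZ hlim ↦ ?_
  refine hC.closed (fun n ↦ graphPlan υ (Z n)) _ hZ (graphPlan_mem_plans hυ Z') ?_
  refine tendsto_of_tendsto_of_tendsto_of_le_of_le tendsto_const_nhds
    (tendsto_iff_edist_tendsto_0.1 hlim) (fun _ ↦ zero_le) fun n ↦ ?_
  simp only [edist_eq_enorm_sub]
  exact fibreDist_graphPlan_le hυ _ _

lemma memLp_snd (hυ : υ ∈ Plans ϱ) :
    MemLp (fun p : Eu d × Eu d ↦ p.2) 2 (υ : Measure (Eu d × Eu d)) :=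
  memLp_two_of_lintegral_lt_top (by fun_prop) (lintegral_snd_sq_lt_top hυ.1)

lemma graphPlan_snd (hυ : υ ∈ Plans ϱ) : graphPlan υ (memLp_snd hυ).toLp = υ := by
  apply Subtype.ext
  refine (graphPlan_congr (memLp_snd hυ).coeFn_toLp).trans ?_
  exact Measure.map_id

lemma pairPlan_snd (hυ : υ ∈ Plans ϱ) (Z : Lp (Eu d) 2 (υ : Measure (Eu d × Eu d))) :
    pairPlan υ (memLp_snd hυ).toLp Z = inducedPlan υ Z := by
  apply Subtype.ext
  change Measure.map _ _ = Measure.map _ _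
  refine Measure.map_congr ?_
  filter_upwards [(memLp_snd hυ).coeFn_toLp] with p hp
  rw [hp]

lemma exists_barycentre_Lp (hC : IsClosedConvex ϱ C) (hCom : HullStable ϱ C) (hυ : υ ∈ Plans ϱ)
    {η : ProbabilityMeasure (Eu d × Eu d)} (hη : η ∈ C)
    {α : ProbabilityMeasure (Eu d × Eu d × Eu d)} (hα : α ∈ Adm υ η) :
    ∃ Z : Lp (Eu d) 2 (υ : Measure (Eu d × Eu d)), graphPlan υ Z ∈ C ∧
      ∫⁻ p, ‖p.2.1 - p.2.2‖ₑ ^ 2 ∂(α : Measure (Eu d × Eu d × Eu d)) =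
        ‖(memLp_snd hυ).toLp - Z‖ₑ ^ 2 +
        ∫⁻ p, ‖Z (p.1, p.2.1) - p.2.2‖ₑ ^ 2 ∂(α : Measure (Eu d × Eu d × Eu d)) := by
  obtain ⟨Z, hZ, h⟩ := exists_barycentre hCom hυ (hC.subset hη) hη hα
  refine ⟨Z, hZ, ?_⟩
  rw [h, ← lintegral_sub_sq_Lp]
  congr 1
  refine lintegral_congr_ae ?_
  filter_upwards [(memLp_snd hυ).coeFn_toLp] with p hp
  rw [hp]

/-- Projection of the second coordinate onto the maps that induce plans in `C`. -/
lemma exists_projection_map (hC : IsClosedConvex ϱ C) (hCom : HullStable ϱ C)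
    (hυ : υ ∈ Plans ϱ) :
    ∃ Z : Lp (Eu d) 2 (υ : Measure (Eu d × Eu d)), graphPlan υ Z ∈ C ∧
      ∀ W : Lp (Eu d) 2 (υ : Measure (Eu d × Eu d)), graphPlan υ W ∈ C →
        ‖(memLp_snd hυ).toLp - Z‖ₑ ^ 2 + ‖W - Z‖ₑ ^ 2 ≤ ‖(memLp_snd hυ).toLp - W‖ₑ ^ 2 := by
  set u := (memLp_snd hυ).toLp
  -- Any admissible plan towards any element of `C` provides a barycentre.
  have hne : {Z : Lp (Eu d) 2 (υ : Measure (Eu d × Eu d)) | graphPlan υ Z ∈ C}.Nonempty := by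
    obtain ⟨η, hη⟩ := hC.nonempty
    obtain ⟨α, hα, -⟩ := exists_adm_le hυ (hC.subset hη) one_ne_zero
    obtain ⟨Z, hZ, -⟩ := exists_barycentre_Lp hC hCom hυ hη hα
    exact ⟨Z, hZ⟩
  have hconv := convex_graphPlan_mem hC hυ
  obtain ⟨Z, hZ, hmin⟩ := exists_norm_eq_iInf_of_complete_convex hne
    (isClosed_graphPlan_mem hC hυ).isComplete hconv u
  rw [norm_eq_iInf_iff_real_inner_le_zero hconv hZ] at hmin
  refine ⟨Z, hZ, fun W hW ↦ ?_⟩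
  have h := hmin W hW
  -- By the variational inequality the inner product is nonpositive, so its term can be dropped.
  have hexp : ‖u - W‖ ^ 2 = ‖u - Z‖ ^ 2 - 2 * inner ℝ (u - Z) (W - Z) + ‖W - Z‖ ^ 2 := by
    rw [← norm_sub_sq_real]; congr 2; abel
  rw [← ofReal_norm, ← ofReal_norm, ← ofReal_norm, ← ENNReal.ofReal_pow (norm_nonneg _),
    ← ENNReal.ofReal_pow (norm_nonneg _), ← ENNReal.ofReal_pow (norm_nonneg _),
    ← ENNReal.ofReal_add (by positivity) (by positivity)]
  exact ENNReal.ofReal_le_ofReal (by linarith)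

/-- An induced plan is concentrated on the graph of its map, hence determines the map almost
everywhere. -/
lemma inducedPlan_injective : Function.Injective (inducedPlan υ) := by
  intro Z Z' h
  have hm := (Lp.stronglyMeasurable Z).measurable
  have hm' := (Lp.stronglyMeasurable Z').measurable
  have h' : (inducedPlan υ Z : Measure (Eu d × Eu d × Eu d)) = inducedPlan υ Z' := by rw [h]
  simp only [inducedPlan, ProbabilityMeasure.toMeasure_map] at h'
  have hS : MeasurableSet {p : Eu d × Eu d × Eu d | Z (p.1, p.2.1) = p.2.2} :=
    measurableSet_eq_fun (by fun_prop) (by fun_prop)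
  have h₁ : ∀ᵐ p ∂(υ : Measure (Eu d × Eu d)).map (fun p ↦ (p.1, p.2, Z p)),
      Z (p.1, p.2.1) = p.2.2 :=
    (ae_map_iff (by fun_prop) hS).2 (ae_of_all _ fun _ ↦ rfl)
  rw [h'] at h₁
  exact Lp.ext ((ae_map_iff (by fun_prop) hS).1 h₁)

/-! ### Minimality, uniqueness and rigidity of optimal plans. -/

lemma le_fibreDist_of_projection_map (hC : IsClosedConvex ϱ C) (hCom : HullStable ϱ C)
    (hυ : υ ∈ Plans ϱ) {Z : Lp (Eu d) 2 (υ : Measure (Eu d × Eu d))}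
    (hmin : ∀ W : Lp (Eu d) 2 (υ : Measure (Eu d × Eu d)), graphPlan υ W ∈ C →
      ‖(memLp_snd hυ).toLp - Z‖ₑ ^ 2 + ‖W - Z‖ₑ ^ 2 ≤ ‖(memLp_snd hυ).toLp - W‖ₑ ^ 2)
    {η : ProbabilityMeasure (Eu d × Eu d)} (hη : η ∈ C) :
    ‖(memLp_snd hυ).toLp - Z‖ₑ ≤ fibreDist ϱ υ η := by
  refine ENNReal.le_of_forall_pos_le_add fun ε hε _ ↦ ?_
  obtain ⟨α, hα, hc⟩ := exists_adm_le hυ (hC.subset hη)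
    (ε₀ := ε) (by simpa using hε.ne')
  obtain ⟨W, hW, h⟩ := exists_barycentre_Lp hC hCom hυ hη hα
  refine le_trans ?_ hc
  rw [← ENNReal.pow_le_pow_left_iff two_ne_zero, rpow_half_sq, h]
  exact le_add_right (le_self_add.trans (hmin W hW))

lemma eq_graphPlan_of_fibreDist_le (hC : IsClosedConvex ϱ C) (hCom : HullStable ϱ C)
    (hυ : υ ∈ Plans ϱ) {Z : Lp (Eu d) 2 (υ : Measure (Eu d × Eu d))}
    (hmin : ∀ W : Lp (Eu d) 2 (υ : Measure (Eu d × Eu d)), graphPlan υ W ∈ C →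
      ‖(memLp_snd hυ).toLp - Z‖ₑ ^ 2 + ‖W - Z‖ₑ ^ 2 ≤ ‖(memLp_snd hυ).toLp - W‖ₑ ^ 2)
    {ζ : ProbabilityMeasure (Eu d × Eu d)} (hζ : ζ ∈ C)
    (hle : fibreDist ϱ υ ζ ≤ ‖(memLp_snd hυ).toLp - Z‖ₑ) : graphPlan υ Z = ζ := by
  have hZm := (Lp.stronglyMeasurable Z).measurable
  set D : ℝ≥0∞ := ‖(memLp_snd hυ).toLp - Z‖ₑ
  have hD : D ≠ ∞ := enorm_ne_top
  refine eq_of_forall_exists_adm fun δ hδ ↦ ?_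
  -- The excess of `(D + ε)²` over `D²` bounds both remainders together; the outer factor `2` comes
  -- from `enorm_sub_sq_le`.
  obtain ⟨ε, hε, hεδ⟩ : ∃ ε : ℝ≥0∞, ε ≠ 0 ∧ 2 * (2 * D * ε + ε ^ 2) ≤ δ := by
    have ht : Tendsto (fun ε : ℝ≥0∞ ↦ 2 * (2 * D * ε + ε ^ 2)) (𝓝[≠] 0)
        (𝓝 (2 * (2 * D * 0 + 0 ^ 2))) := by
      refine Tendsto.mono_left ?_ nhdsWithin_le_nhds
      refine ENNReal.Tendsto.const_mul (Tendsto.add ?_ ?_) (Or.inr (by norm_num))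
      · exact ENNReal.Tendsto.const_mul tendsto_id
          (Or.inr (ENNReal.mul_ne_top (by norm_num) hD))
      · exact ENNReal.Tendsto.pow tendsto_id
    have h0 : 2 * (2 * D * 0 + 0 ^ 2) < δ := by simpa using pos_iff_ne_zero.2 hδ
    obtain ⟨ε, h₁, h₂⟩ := ((ht.eventually_lt_const h0).and self_mem_nhdsWithin).exists
    exact ⟨ε, h₂, h₁.le⟩
  obtain ⟨α, hα, hc⟩ := exists_adm_le hυ (hC.subset hζ) hε
  obtain ⟨W, hW, h⟩ := exists_barycentre_Lp hC hCom hυ hζ hα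
  set B := ∫⁻ p, ‖W (p.1, p.2.1) - p.2.2‖ₑ ^ 2 ∂(α : Measure (Eu d × Eu d × Eu d))
  have hWm := (Lp.stronglyMeasurable W).measurable
  have hbound : ‖W - Z‖ₑ ^ 2 + B ≤ 2 * D * ε + ε ^ 2 := by
    refine (ENNReal.add_le_add_iff_left (a := D ^ 2) (by finiteness)).1 ?_
    calc D ^ 2 + (‖W - Z‖ₑ ^ 2 + B) = D ^ 2 + ‖W - Z‖ₑ ^ 2 + B := by ring
      _ ≤ ‖(memLp_snd hυ).toLp - W‖ₑ ^ 2 + B := by gcongr; exact hmin W hW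
      _ ≤ (D + ε) ^ 2 := by
        rw [← h, ← rpow_half_sq (lintegral _ _)]
        gcongr
        exact hc.trans (by gcongr)
      _ = D ^ 2 + (2 * D * ε + ε ^ 2) := by ring
  have hm : Measurable fun p : Eu d × Eu d × Eu d ↦ (p.1, Z (p.1, p.2.1), p.2.2) := by fun_prop
  -- Replacing `y¹` by `Z(x, y¹)` in the almost optimal plan joins `(x, Z)#υ` to `ζ`.
  refine ⟨α.map (f := fun p ↦ (p.1, Z (p.1, p.2.1), p.2.2)) hm.aemeasurable, ?_, ?_⟩
  · refine mem_adm_of_map (graphPlan_mem_plans hυ Z).1 (hC.subset hζ).1 ?_ ?_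
    · rw [ProbabilityMeasure.toMeasure_map, Measure.map_map (by fun_prop) hm, graphPlan,
        ProbabilityMeasure.toMeasure_map, Adm.map_left hα (by fun_prop)]
      rfl
    · rw [ProbabilityMeasure.toMeasure_map, Measure.map_map (by fun_prop) hm, ← hα.2.2]
      rfl
  · rw [ProbabilityMeasure.toMeasure_map, lintegral_map (by fun_prop) hm]
    refine le_trans ?_ hεδ
    calc ∫⁻ p, ‖Z (p.1, p.2.1) - p.2.2‖ₑ ^ 2 ∂(α : Measure (Eu d × Eu d × Eu d))
        ≤ ∫⁻ p, 2 * (‖W (p.1, p.2.1) - Z (p.1, p.2.1)‖ₑ ^ 2 + ‖W (p.1, p.2.1) - p.2.2‖ₑ ^ 2)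
            ∂(α : Measure (Eu d × Eu d × Eu d)) :=
          lintegral_mono fun p ↦ enorm_sub_sq_le _ _ _
      _ = 2 * (‖W - Z‖ₑ ^ 2 + B) := by
        rw [lintegral_const_mul _ (by fun_prop), lintegral_add_left (by fun_prop),
          ← lintegral_sub_sq_Lp, Adm.lintegral_left hα (by fun_prop)]
      _ ≤ _ := by gcongr

lemma eq_inducedPlan_of_cost_le (hC : IsClosedConvex ϱ C) (hCom : HullStable ϱ C)
    (hυ : υ ∈ Plans ϱ) {Z : Lp (Eu d) 2 (υ : Measure (Eu d × Eu d))}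
    (hmin : ∀ W : Lp (Eu d) 2 (υ : Measure (Eu d × Eu d)), graphPlan υ W ∈ C →
      ‖(memLp_snd hυ).toLp - Z‖ₑ ^ 2 + ‖W - Z‖ₑ ^ 2 ≤ ‖(memLp_snd hυ).toLp - W‖ₑ ^ 2)
    {ζ : ProbabilityMeasure (Eu d × Eu d)} (hζ : ζ ∈ C)
    {α : ProbabilityMeasure (Eu d × Eu d × Eu d)} (hα : α ∈ Adm υ ζ)
    (hle : ∫⁻ p, ‖p.2.1 - p.2.2‖ₑ ^ 2 ∂(α : Measure (Eu d × Eu d × Eu d)) ≤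
      ‖(memLp_snd hυ).toLp - Z‖ₑ ^ 2) : α = inducedPlan υ Z := by
  obtain ⟨W, hW, h⟩ := exists_barycentre_Lp hC hCom hυ hζ hα
  have hWm := (Lp.stronglyMeasurable W).measurable
  rw [h] at hle
  have h0 := (add_le_add_left (hmin W hW) _).trans hle
  rw [add_assoc] at h0
  -- Cancelling the finite minimal cost leaves `‖W - Z‖²` and the conditional variance with sum
  -- zero.
  have h0' := (ENNReal.add_le_add_iff_left (c := 0) (by finiteness)).1 (h0.trans (add_zero _).ge)
  rw [nonpos_iff_eq_zero, add_eq_zero] at h0'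
  have hWZ : W = Z := by simpa [sub_eq_zero] using h0'.1
  subst hWZ
  have hae := (lintegral_eq_zero_iff (by fun_prop)).1 h0'.2
  apply Subtype.ext
  change (α : Measure (Eu d × Eu d × Eu d)) = Measure.map _ _
  rw [Adm.map_left hα (by fun_prop)]
  conv_lhs => rw [← Measure.map_id (μ := (α : Measure (Eu d × Eu d × Eu d)))]
  refine Measure.map_congr ?_
  filter_upwards [hae] with p hp
  have : W (p.1, p.2.1) - p.2.2 = 0 := by simpa using hp
  simp only [id, sub_eq_zero.1 this]

end

end FibreTransport

end

theorem mainTheorem5 {d : ℕ} (ϱ : MeasureTheory.ProbabilityMeasure (FibreTransport.Eu d))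
    (hϱ : FibreTransport.FiniteSecondMoment ϱ)
    (C : Set (MeasureTheory.ProbabilityMeasure (FibreTransport.Eu d × FibreTransport.Eu d)))
    (hC : FibreTransport.IsClosedConvex ϱ C) (hCom : FibreTransport.HullStable ϱ C)
    (υ : MeasureTheory.ProbabilityMeasure (FibreTransport.Eu d × FibreTransport.Eu d))
    (hυ : υ ∈ FibreTransport.Plans ϱ) :
    (∃! ζ, FibreTransport.IsMetricProjection ϱ C υ ζ) ∧
    ∀ ζ, FibreTransport.IsMetricProjection ϱ C υ ζ →
      ∃! Z : MeasureTheory.Lp (FibreTransport.Eu d) 2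
          (υ : MeasureTheory.Measure (FibreTransport.Eu d × FibreTransport.Eu d)),
        FibreTransport.Opt ϱ υ ζ = {FibreTransport.inducedPlan υ Z} := by
  open FibreTransport in
  obtain ⟨Z, hZ, hmin⟩ := exists_projection_map hC hCom hυ
  have hle : fibreDist ϱ υ (graphPlan υ Z) ≤ ‖(memLp_snd hυ).toLp - Z‖ₑ := by
    have := fibreDist_graphPlan_le hυ (memLp_snd hυ).toLp Z
    rwa [graphPlan_snd hυ] at this
  have hge := fun η hη ↦ le_fibreDist_of_projection_map hC hCom hυ hmin (η := η) hη
  have huniq : ∀ ζ, IsMetricProjection ϱ C υ ζ → graphPlan υ Z = ζ := fun ζ hζ ↦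
    eq_graphPlan_of_fibreDist_le hC hCom hυ hmin hζ.1 ((hζ.2 _ hZ).trans hle)
  refine ⟨⟨graphPlan υ Z, ⟨hZ, fun η hη ↦ hle.trans (hge η hη)⟩, fun ζ hζ ↦ (huniq ζ hζ).symm⟩, ?_⟩
  intro ζ hζ
  obtain rfl := huniq ζ hζ
  have hdist : fibreDist ϱ υ (graphPlan υ Z) = ‖(memLp_snd hυ).toLp - Z‖ₑ :=
    le_antisymm hle (hge _ hZ)
  have hopt : Opt ϱ υ (graphPlan υ Z) = {inducedPlan υ Z} := by
    ext α
    rw [Set.mem_singleton_iff]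
    constructor
    · rintro ⟨hα, hc⟩
      exact eq_inducedPlan_of_cost_le hC hCom hυ hmin hZ hα (by rw [← hc, hdist])
    · rintro rfl
      rw [← pairPlan_snd hυ]
      refine ⟨?_, by rw [hdist, lintegral_pairPlan]⟩
      have := pairPlan_mem_adm hυ (memLp_snd hυ).toLp Z
      rwa [graphPlan_snd hυ] at this
  refine ⟨Z, hopt, fun Z' hZ' ↦ ?_⟩
  have := hopt.symm.trans hZ'
  exact (inducedPlan_injective (Set.singleton_injective this)).symm
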